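/- Let $(S,\mathfrak n)$ be a Cohen–Macaulay local ring of dimension $d+1$ with $d\ge 1$, let $f\in\mathfrak n$ be a nonzerodivisor on $S$, and set $R=S/(f)$. Let $a_1,\dots,a_d,b\in\mathfrak n$ be a system of parameters of $S$, and suppose that $b^2+\sum_{i=1}^d a_ix_i=\varepsilon f$ with $x_1,\dots,x_d\in(a_1,\dots,a_d,b)$ and $\varepsilon\in S$ a unit. Let $I=(\overline{a_1},\dots,\overline{a_d},\overline b)\subseteq R$ be the ideal generated by the images of $a_1,\dots,a_d,b$ in $R$. Let $K=(K_\bullet,\partial^K_\bullet)$ and $L=(K_\bullet,\partial^L_\bullet)$ be the Koszul complexes over $S$ of $a_1,\dots,a_d$ and of $x_1,\dots,x_d$. Their differentials are written as matrices in the bases $T_J=T_{j_1}\wedge\cdots\wedge T_{j_p}$ of $K_p$, for $J=\{j_1<\cdots<j_p\}\subseteq\{1,\dots,d\}$: the $(J\setminus\{j_\alpha\},J)$ entry of $\partial^K_p$ (resp. $\partial^L_p$) is $(-1)^{\alpha+1}a_{j_\alpha}$ (resp. $(-1)^{\alpha+1}x_{j_\alpha}$), and all other entries are $0$. Put $G_0=K_0=S$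 and $G_i=K_i\oplus G_{i-1}$ for $i\ge1$, so that $G_i$ is free of rank $\sum_{j=0}^i\binom dj$. Define $\partial_i\colon G_i\to G_{i-1}$ for $i\ge 1$ by the block matrices $$\partial_1=\left[\begin{array}{c|c}\partial^K_1&b\end{array}\right],\qquad \partial_2=\left[\begin{array}{c|c}\partial^K_2&-bE_d\mid{}^t\partial^L_1\\\hline O&\partial_1\end{array}\right],$$ $$\partial_i=\left[\begin{array}{c|c}\partial^K_i&(-1)^{i-1}bE_{\binom d{i-1}}\mid{}^t\partial^L_{i-1}\mid O\\\hline O&\partial_{i-1}\end{array}\right]\quad(i\ge3),$$ where $E_n$ is the $n\times n$ identity matrix and ${}^t$ denotes the transpose. Then: 1. With $g=\varepsilon f$, $\ \partial_i\,\partial_{i+1}=\left[\begin{array}{c|c}O&gE_{\sum_{j=0}^{i-1}\binom dj}\end{array}\right]$ for every $i\ge1$. 2. For $i\ge d$ one has $G_i=G_d$ (because $K_j=0$ for $j>d$), and $\partial_i=\partial_{d+1}$ for every $i\ge d+1$. 3. $R$ is a local ring and, with $F_i=G_i\otimes_SR$ and $\overline{\partial_i}=\partial_i\otimes_SR$, the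 sequence $$\cdots\to F_i\xrightarrow{\ \overline{\partial_i}\ }F_{i-1}\to\cdots\to F_1\xrightarrow{\ \overline{\partial_1}\ }F_0=R\to R/I\to0$$ is a minimal free resolution of the $R$-module $R/I$; that is, it is exact, every $F_i$ is free of finite rank, and $\overline{\partial_i}(F_i)\subseteq\mathfrak m F_{i-1}$ for every $i\ge1$, where $\mathfrak m$ is the maximal ideal of $R$. -/

import Mathlib

/-- A Noetherian local ring is Cohen–Macaulay if its depth equals its dimension, i.e. if its maximal
ideal contains a regular sequence whose length is the Krull dimension of the ring. -/
def IsCohenMacaulayLocalRing (S : Type*) [CommRing S] [IsLocalRing S] : Prop :=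
  IsNoetherianRing S ∧
    ∃ rs : List S, (∀ r ∈ rs, r ∈ IsLocalRing.maximalIdeal S) ∧
      RingTheory.Sequence.IsRegular S rs ∧ (rs.length : WithBot ℕ∞) = ringKrullDim S

/-- `s₁, …, sₙ` is a system of parameters of the (Noetherian) local ring `S`: the number `n` is the
dimension of `S` and the ideal `(s₁, …, sₙ)` is primary to the maximal ideal. -/
def IsSystemOfParameters {S : Type*} [CommRing S] [IsLocalRing S] {n : ℕ} (s : Fin n → S) : Prop :=
  (n : WithBot ℕ∞) = ringKrullDim S ∧
    (Ideal.span (Set.range s)).radical = IsLocalRing.maximalIdeal S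

/-- The subsets `I = {j₁ < ⋯ < j_p}` of the `d`-element set. They index the standard basis
`T_I = T_{j₁} ∧ ⋯ ∧ T_{j_p}` of the `p`-th module of a Koszul complex on `d` elements. -/
abbrev KoszulIndex (d p : ℕ) : Type := {I : Finset (Fin d) // I.card = p}

/-- The matrix of the Koszul differential `K_{p+1} → K_p` of `a₁, …, a_d` in the standard bases.
Its entry at `(I, J)` is `(-1)^(α+1) a_{j_α}` if `J = {j₁ < ⋯ < j_{p+1}}` and `I = J \ {j_α}`, and `0`
if `I ⊈ J`. Here `α - 1` is the number of elements of `J` below `j_α`. -/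
def koszulMatrix {S : Type*} [CommRing S] {d : ℕ} (a : Fin d → S) (p : ℕ) :
    Matrix (KoszulIndex d p) (KoszulIndex d (p + 1)) S :=
  Matrix.of fun I J =>
    ∑ j ∈ J.1, if I.1 = J.1.erase j then (-1) ^ (J.1.filter (· < j)).card * a j else 0

/-- The index set of the standard basis of `G_i`, where `G_0 = K_0` and `G_i = K_i ⊕ G_{i-1}`. -/
def GIndex (d : ℕ) : ℕ → Type
  | 0 => KoszulIndex d 0
  | i + 1 => KoszulIndex d (i + 1) ⊕ GIndex d i

instance GIndex.instFintype (d : ℕ) : (i : ℕ) → Fintype (GIndex d i)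
  | 0 => inferInstanceAs (Fintype (KoszulIndex d 0))
  | i + 1 =>
    haveI := GIndex.instFintype d i
    inferInstanceAs (Fintype (KoszulIndex d (i + 1) ⊕ GIndex d i))

instance GIndex.instDecidableEq (d : ℕ) : (i : ℕ) → DecidableEq (GIndex d i)
  | 0 => inferInstanceAs (DecidableEq (KoszulIndex d 0))
  | i + 1 =>
    haveI := GIndex.instDecidableEq d i
    inferInstanceAs (DecidableEq (KoszulIndex d (i + 1) ⊕ GIndex d i))

/-- The block row `[ᵗ∂^L_{i+1} | O]` from `G_i` to `K_{i+1}`, where `L` is the Koszul complex of `x`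
(the zero block is absent for `i = 0`). -/
def transposeRow {S : Type*} [CommRing S] {d : ℕ} (x : Fin d → S) :
    (i : ℕ) → Matrix (KoszulIndex d (i + 1)) (GIndex d i) S
  | 0 => (koszulMatrix x 0).transpose
  | i + 1 => Matrix.fromCols (koszulMatrix x (i + 1)).transpose
      (0 : Matrix (KoszulIndex d (i + 2)) (GIndex d i) S)

/-- `gMatrix a x b i` is the matrix of `∂_{i+1} : G_{i+1} → G_i`:
`∂₁ = [∂^K₁ | b]` and
`∂_{i+2} = [ ∂^K_{i+2}, (-1)^{i+1} b E | ᵗ∂^L_{i+1} | O ; O, ∂_{i+1} ]`,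
where `K` and `L` are the Koszul complexes of `a` and of `x`. -/
def gMatrix {S : Type*} [CommRing S] {d : ℕ} (a x : Fin d → S) (b : S) :
    (i : ℕ) → Matrix (GIndex d i) (GIndex d (i + 1)) S
  | 0 => Matrix.fromCols (koszulMatrix a 0) (b • (1 : Matrix (KoszulIndex d 0) (KoszulIndex d 0) S))
  | i + 1 =>
    Matrix.fromBlocks
      (koszulMatrix a (i + 1))
      (Matrix.fromCols
        (((-1) ^ (i + 1) * b) • (1 : Matrix (KoszulIndex d (i + 1)) (KoszulIndex d (i + 1)) S))
        (transposeRow x i))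
      0
      (gMatrix a x b i)

/-- The inclusion of the standard basis of `G_i` into that of `G_{i+k}`, coming from the direct
summands `G_i ⊆ K_{i+1} ⊕ G_i = G_{i+1} ⊆ ⋯ ⊆ G_{i+k}`. -/
def GIndex.incl (d i : ℕ) : (k : ℕ) → GIndex d i → GIndex d (i + k)
  | 0 => id
  | k + 1 => fun u => Sum.inr (GIndex.incl d i k u)

/-- The map `∂_{i+1} ⊗ R : F_{i+1} → F_i`, where `F_i = G_i ⊗ R` and `R = S/(f)`. -/
def fMap {S : Type*} [CommRing S] {d : ℕ} (f : S) (a x : Fin d → S) (b : S) (i : ℕ) :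
    (GIndex d (i + 1) → S ⧸ Ideal.span {f}) →ₗ[S ⧸ Ideal.span {f}]
      (GIndex d i → S ⧸ Ideal.span {f}) :=
  Matrix.mulVecLin ((gMatrix a x b i).map (Ideal.Quotient.mk (Ideal.span {f})))

/-- The augmentation `F_0 = R → R/I`; the only basis element of `F_0` is `T_∅`. -/
def augmentation {R : Type*} [CommRing R] (d : ℕ) (I : Ideal R) :
    (GIndex d 0 → R) →ₗ[R] R ⧸ I :=
  I.mkQ ∘ₗ LinearMap.proj (⟨∅, Finset.card_empty⟩ : KoszulIndex d 0)

/-- `⋯ → F 2 → F 1 → F 0 → M → 0` is a minimal free resolution of the module `M` over the local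
ring `R`: the modules `F i` are free of finite rank, the sequence is exact, and every differential
`∂ i : F (i + 1) → F i` has its image in `𝔪 • F i`. -/
structure IsMinimalFreeResolution {R : Type*} [CommRing R] [IsLocalRing R]
    {M : Type*} [AddCommGroup M] [Module R M]
    (F : ℕ → Type*) [∀ i, AddCommGroup (F i)] [∀ i, Module R (F i)]
    (diff : ∀ i, F (i + 1) →ₗ[R] F i) (aug : F 0 →ₗ[R] M) : Prop where
  free : ∀ i, Module.Free R (F i)
  finite : ∀ i, Module.Finite R (F i)
  exact : ∀ i, Function.Exact (diff (i + 1)) (diff i)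
  exact_zero : Function.Exact (diff 0) aug
  surjective : Function.Surjective aug
  minimal : ∀ i, LinearMap.range (diff i) ≤
    IsLocalRing.maximalIdeal R • (⊤ : Submodule R (F i))

/-!
The product formula is a block computation. It rests on two facts about Koszul matrices:
`koszulMatrix_mul_koszulMatrix` (the Koszul complex is a complex) and
`koszulMatrix_mul_transpose_add` (`∂^K ᵗ∂^L + ᵗ∂^L ∂^K` is multiplication by `∑ aᵢ xᵢ`).

For exactness, write `K` for the Koszul complex of `a`. Over `R` the complex `F` is an extension
`0 → K_R → F → F[-1] → 0`, so by induction on the degree it is exact in positive degrees as soon as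
`K_R` is, and the connecting map `H_0(F) = R/I → H_0(K_R) = R/(a)`, which is multiplication by `b`,
is injective (`gMatrix_exactMod`). All exactness statements are about matrices over `S` whose
vectors are taken modulo an ideal (`ExactMod`); this avoids changing the ring.

Both conditions follow from acyclicity of the Koszul complex of `a, b` over `S`. That is a case of
depth sensitivity (`exactMod_of_isWeaklyRegular`): the Cohen–Macaulay hypothesis gives a regular
sequence of length `d + 1` in the maximal ideal, and each of its elements has a power in `(a, b)`,
which is therefore homotopic to zero on the complex. Writing the Koszul complex of `a, b` as the
mapping cone of `b` on `K`, acyclicity says that `b` is regular modulo `a`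
(`mem_of_mul_mem_of_coneMatrix_exact`) and, by Nakayama's lemma, that `K` is acyclic
(`koszulMatrix_exact`). As `ε f ≡ b²` modulo `a`, the element `f` is regular modulo `a`, so `K`
remains acyclic modulo `f` (`koszulMatrix_exactMod_span_singleton`), and `b s ∈ (a) + (f)` implies
`s ∈ (a, b)`.
-/

/-! ### Koszul matrices -/

/-- The sign of the entries of the Koszul differential: `(-1)` to the number of elements of `J`
below `j`. It does not depend on whether `j ∈ J`. -/
def koszulSign {d : ℕ} (S : Type*) [CommRing S] (j : Fin d) (J : Finset (Fin d)) : S :=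
  (-1) ^ (J.filter (· < j)).card

section
variable {S : Type*} [CommRing S] {d : ℕ}

lemma koszulSign_mul_self (j : Fin d) (J : Finset (Fin d)) :
    koszulSign S j J * koszulSign S j J = 1 := by
  rw [koszulSign, ← pow_add, Even.neg_one_pow ⟨_, rfl⟩]

lemma koszulSign_insert_self (j : Fin d) (J : Finset (Fin d)) :
    koszulSign S j (insert j J) = koszulSign S j J := by
  simp [koszulSign, Finset.filter_insert]

lemma koszulSign_insert {j k : Fin d} {J : Finset (Fin d)} (hk : k ∉ J) :
    koszulSign S j (insert k J) = (if k < j then -1 else 1) * koszulSign S j J := by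
  simp only [koszulSign, Finset.filter_insert]
  split_ifs with h
  · rw [Finset.card_insert_of_notMem (by simp [hk]), pow_succ]; ring
  · simp

/-- Adjoining `j` and `k` to `J` in the two possible orders gives opposite signs. -/
lemma koszulSign_insert_mul {j k : Fin d} {J : Finset (Fin d)} (hjk : j ≠ k) (hj : j ∉ J)
    (hk : k ∉ J) :
    koszulSign S j (insert k J) * koszulSign S k J
      = -(koszulSign S k (insert j J) * koszulSign S j J) := by
  rw [koszulSign_insert hk, koszulSign_insert hj]
  rcases lt_or_gt_of_ne hjk with h | h
  · simp [h, h.not_gt]; ring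
  · simp [h, h.not_gt]; ring

/-- The entries of the Koszul matrix in terms of adjoining an element to the row index, instead of
removing one from the column index. -/
lemma koszulMatrix_apply (a : Fin d → S) (p : ℕ) (I : KoszulIndex d p)
    (J : KoszulIndex d (p + 1)) :
    koszulMatrix a p I J =
      ∑ j, if j ∉ I.1 ∧ J.1 = insert j I.1 then koszulSign S j I.1 * a j else 0 := by
  have h : ∀ j, (j ∈ J.1 ∧ I.1 = J.1.erase j) ↔ (j ∉ I.1 ∧ J.1 = insert j I.1) := fun j => by
    constructor
    · rintro ⟨h1, h2⟩
      rw [h2]; simp [h1]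
    · rintro ⟨h1, h2⟩
      rw [h2]; simp [h1]
  rw [koszulMatrix, Matrix.of_apply, ← Finset.sum_filter, ← Finset.sum_filter,
    Finset.filter_congr (q := fun j => j ∈ J.1 ∧ I.1 = J.1.erase j) (fun j _ => (h j).symm),
    Finset.filter_and, Finset.filter_mem_eq_inter, Finset.univ_inter]
  have : J.1 ∩ Finset.univ.filter (fun j => I.1 = J.1.erase j)
      = J.1.filter (fun j => I.1 = J.1.erase j) := by ext; simp
  rw [this]
  refine Finset.sum_congr rfl fun j hj => ?_
  rw [Finset.mem_filter] at hj
  rw [((h j).1 hj).2, ← koszulSign_insert_self]; rfl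

theorem koszulMatrix_mul_koszulMatrix (a : Fin d → S) (p : ℕ) :
    koszulMatrix a p * koszulMatrix a (p + 1) = 0 := by
  ext I K
  -- the contribution of adjoining `j` to `I`, then `k`
  set T : Fin d × Fin d → S := fun jk =>
    if jk.1 ≠ jk.2 ∧ jk.1 ∉ I.1 ∧ jk.2 ∉ I.1 ∧ K.1 = insert jk.2 (insert jk.1 I.1) then
      koszulSign S jk.1 I.1 * a jk.1 * (koszulSign S jk.2 (insert jk.1 I.1) * a jk.2) else 0
  have key : (koszulMatrix a p * koszulMatrix a (p + 1)) I K = ∑ jk, T jk := by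
    simp only [Matrix.mul_apply, koszulMatrix_apply, Finset.sum_mul_sum]
    rw [Finset.sum_comm, Fintype.sum_prod_type]
    refine Finset.sum_congr rfl fun j _ => ?_
    rw [Finset.sum_comm]
    refine Finset.sum_congr rfl fun k _ => ?_
    by_cases hj : j ∈ I.1
    · simp [T, hj]
    · rw [Finset.sum_eq_single ⟨insert j I.1, by rw [Finset.card_insert_of_notMem hj, I.2]⟩]
      · simp only [hj, T, not_false_eq_true, and_self, if_true, Finset.mem_insert, not_or]
        by_cases hjk : k = j
        · simp [hjk]
        · simp [hjk, Ne.symm hjk]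
      · intro J _ hJ
        rw [if_neg (fun h => hJ (Subtype.ext h.2)), zero_mul]
      · simp
  rw [key, Matrix.zero_apply]
  refine Finset.sum_involution (fun jk _ => jk.swap) ?_ ?_ (fun _ _ => Finset.mem_univ _)
    (fun _ _ => Prod.swap_swap _)
  · rintro ⟨j, k⟩ -
    simp only [T, Prod.swap]
    by_cases h : j ≠ k ∧ j ∉ I.1 ∧ k ∉ I.1 ∧ K.1 = insert k (insert j I.1)
    · obtain ⟨h1, h2, h3, h4⟩ := h
      rw [if_pos ⟨h1, h2, h3, h4⟩, if_pos ⟨h1.symm, h3, h2, by rw [h4, Finset.insert_comm]⟩]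
      linear_combination a j * a k * koszulSign_insert_mul (S := S) h1 h2 h3
    · rw [if_neg h, if_neg, add_zero]
      rintro ⟨h1, h2, h3, h4⟩
      exact h ⟨h1.symm, h3, h2, by rw [h4, Finset.insert_comm]⟩
  · rintro ⟨j, k⟩ - h h'
    simp only [Prod.swap, Prod.mk.injEq] at h'
    exact h (by simp [T, h'.1])

lemma koszulMatrix_mul_transpose_apply (a x : Fin d → S) (p : ℕ) (I I' : KoszulIndex d p) :
    (koszulMatrix a p * (koszulMatrix x p).transpose) I I' =
      ∑ j, ∑ k, if j ∉ I.1 ∧ k ∉ I'.1 ∧ insert j I.1 = insert k I'.1 then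
        koszulSign S j I.1 * a j * (koszulSign S k I'.1 * x k) else 0 := by
  simp only [Matrix.mul_apply, Matrix.transpose_apply, koszulMatrix_apply, Finset.sum_mul_sum]
  rw [Finset.sum_comm]
  refine Finset.sum_congr rfl fun j _ => ?_
  rw [Finset.sum_comm]
  refine Finset.sum_congr rfl fun k _ => ?_
  by_cases hj : j ∈ I.1
  · simp [hj]
  · rw [Finset.sum_eq_single ⟨insert j I.1, by rw [Finset.card_insert_of_notMem hj, I.2]⟩]
    · simp [hj]
    · intro J _ hJ
      rw [if_neg (fun h => hJ (Subtype.ext h.2)), zero_mul]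
    · simp

lemma transpose_mul_koszulMatrix_apply (a x : Fin d → S) (p : ℕ) (I I' : KoszulIndex d (p + 1)) :
    ((koszulMatrix x p).transpose * koszulMatrix a p) I I' =
      ∑ j, ∑ k, if k ∈ I.1 ∧ j ∈ I'.1 ∧ I.1.erase k = I'.1.erase j then
        koszulSign S j (I'.1.erase j) * a j * (koszulSign S k (I.1.erase k) * x k) else 0 := by
  simp only [Matrix.mul_apply, Matrix.transpose_apply, koszulMatrix_apply, Finset.sum_mul_sum]
  refine Eq.trans ?_ Finset.sum_comm
  rw [Finset.sum_comm]
  refine Finset.sum_congr rfl fun k _ => ?_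
  rw [Finset.sum_comm]
  refine Finset.sum_congr rfl fun j _ => ?_
  by_cases hk : k ∈ I.1
  · rw [Finset.sum_eq_single ⟨I.1.erase k, by rw [Finset.card_erase_of_mem hk, I.2]; rfl⟩]
    · have h : (j ∉ I.1.erase k ∧ I'.1 = insert j (I.1.erase k)) ↔
          (j ∈ I'.1 ∧ I.1.erase k = I'.1.erase j) := by
        constructor
        · rintro ⟨h1, h2⟩
          rw [h2]; simp [Finset.erase_insert h1]
        · rintro ⟨h1, h2⟩
          rw [h2]; simp [h1]
      simp only [h]
      rw [if_pos ⟨by simp, (Finset.insert_erase hk).symm⟩]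
      simp only [hk, true_and]
      split_ifs with h'
      · rw [h'.2]; ring
      · simp
    · intro J _ hJ
      rw [if_neg, zero_mul]
      rintro ⟨h1, h2⟩
      exact hJ (Subtype.ext (by simp [h2, Finset.erase_insert h1]))
    · simp
  · rw [Finset.sum_eq_zero]
    · simp [hk]
    · intro J _
      rw [if_neg, zero_mul]
      rintro ⟨h1, h2⟩
      exact hk (by rw [h2]; simp)

theorem koszulMatrix_zero_mul_transpose (a x : Fin d → S) :
    koszulMatrix a 0 * (koszulMatrix x 0).transpose = (∑ i, a i * x i) • 1 := by
  ext I I'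
  have hI : I.1 = ∅ := Finset.card_eq_zero.1 I.2
  obtain rfl : I = I' := Subtype.ext (by rw [hI, Finset.card_eq_zero.1 I'.2])
  rw [koszulMatrix_mul_transpose_apply, Matrix.smul_apply, Matrix.one_apply_eq, smul_eq_mul,
    mul_one]
  refine Finset.sum_congr rfl fun j _ => ?_
  simp [hI, koszulSign]

/-- The transpose of the Koszul differential of `x` is a homotopy for multiplication by
`∑ aᵢ xᵢ` on the Koszul complex of `a`. The contributions of `aⱼ xₖ` with `j ≠ k` cancel by
`koszulSign_insert_mul`. -/
theorem koszulMatrix_mul_transpose_add (a x : Fin d → S) (p : ℕ) :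
    koszulMatrix a (p + 1) * (koszulMatrix x (p + 1)).transpose +
      (koszulMatrix x p).transpose * koszulMatrix a p = (∑ i, a i * x i) • 1 := by
  ext I I'
  rw [Matrix.add_apply, koszulMatrix_mul_transpose_apply, transpose_mul_koszulMatrix_apply,
    ← Finset.sum_add_distrib, Matrix.smul_apply, Matrix.one_apply, smul_eq_mul, Finset.sum_mul]
  refine Finset.sum_congr rfl fun j _ => ?_
  rw [← Finset.sum_add_distrib]
  have : a j * x j * (if I = I' then 1 else 0)
      = ∑ k, if k = j then (if I = I' then a j * x k else 0) else 0 := by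
    rw [Finset.sum_ite_eq' Finset.univ j]; simp
  rw [this]
  refine Finset.sum_congr rfl fun k _ => ?_
  by_cases hjk : k = j
  · subst hjk
    rw [if_pos rfl]
    by_cases hI : I = I'
    · subst hI
      by_cases hk : k ∈ I.1
      · simp only [hk, not_true_eq_false, false_and, if_false, true_and, if_true, zero_add]
        linear_combination a k * x k * koszulSign_mul_self (S := S) k (I.1.erase k)
      · simp only [hk, not_false_eq_true, true_and, if_true, false_and, if_false, add_zero]
        linear_combination a k * x k * koszulSign_mul_self (S := S) k I.1
    · rw [if_neg, if_neg, if_neg hI, add_zero]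
      · rintro ⟨h1, h2, h3⟩
        exact hI (Subtype.ext (by rw [← Finset.insert_erase h1, h3, Finset.insert_erase h2]))
      · rintro ⟨h1, h2, h3⟩
        exact hI (Subtype.ext (by rw [← Finset.erase_insert h1, h3, Finset.erase_insert h2]))
  · rw [if_neg hjk]
    by_cases h : k ∈ I.1 ∧ j ∈ I'.1 ∧ I.1.erase k = I'.1.erase j
    · obtain ⟨h1, h2, h3⟩ := h
      -- `I = M ∪ {k}` and `I' = M ∪ {j}`
      obtain ⟨M, hM⟩ : ∃ M, M = I.1.erase k := ⟨_, rfl⟩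
      have e1 : I.1 = insert k M := by rw [hM, Finset.insert_erase h1]
      have e2 : I'.1 = insert j M := by rw [hM, h3, Finset.insert_erase h2]
      have hk : k ∉ M := by simp [hM]
      have hj : j ∉ M := by simp [hM, h3]
      have h' : j ∉ I.1 ∧ k ∉ I'.1 ∧ insert j I.1 = insert k I'.1 := by
        rw [e1, e2, Finset.insert_comm]
        simp [hk, hj, hjk, Ne.symm hjk]
      rw [if_pos h', if_pos ⟨h1, h2, h3⟩, ← h3, ← hM, e1, e2, koszulSign_insert hk,
        koszulSign_insert hj]
      rcases lt_or_gt_of_ne hjk with h | h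
      · simp [h, h.not_gt]
      · simp [h, h.not_gt]
    · rw [if_neg h, add_zero, if_neg]
      rintro ⟨h1, h2, h3⟩
      have m1 : k ∈ I.1 := by
        have : k ∈ insert j I.1 := h3 ▸ Finset.mem_insert_self _ _
        exact (Finset.mem_insert.1 this).resolve_left hjk
      have m2 : j ∈ I'.1 := by
        have : j ∈ insert k I'.1 := h3 ▸ Finset.mem_insert_self _ _
        exact (Finset.mem_insert.1 this).resolve_left (Ne.symm hjk)
      refine h ⟨m1, m2, ?_⟩
      rw [← Finset.erase_insert h1, h3, Finset.erase_right_comm, Finset.erase_insert h2]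

end

/-! ### The product of two consecutive differentials -/

section
variable {S : Type*} [CommRing S] {d : ℕ}

section
variable {κ₁ κ₂ κ₃ γ : Type*} [Fintype κ₁] [DecidableEq κ₁]

lemma fromCols_one_mul_fromBlocks [Fintype γ] {A₁ : Matrix κ₁ κ₂ S} {X : Matrix κ₂ κ₁ S} {t : S}
    {T : Matrix κ₁ γ S} {g : Matrix γ (κ₁ ⊕ γ) S} (hXT : X * T = 0) :
    Matrix.fromCols X (0 : Matrix κ₂ γ S) *
        Matrix.fromBlocks A₁ (Matrix.fromCols (t • (1 : Matrix κ₁ κ₁ S)) T) 0 g =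
      Matrix.fromCols (X * A₁) (t • Matrix.fromCols X (0 : Matrix κ₂ γ S)) := by
  rw [Matrix.fromCols_mul_fromBlocks, Matrix.zero_mul, Matrix.zero_mul, add_zero, add_zero,
    Matrix.mul_fromCols, hXT, Matrix.mul_smul, Matrix.mul_one]
  ext _ (_ | _ | _) <;> simp

/-- The base case of `∂_i ∂_{i+1} = [O | qE]`, as an identity of block matrices. -/
lemma fromCols_mul_fromBlocks_eq [Fintype κ₂] [DecidableEq κ₂] {A₁ : Matrix κ₁ κ₂ S}
    {A₂ : Matrix κ₂ κ₃ S} {X : Matrix κ₂ κ₁ S} {t q : S} (hA : A₁ * A₂ = 0)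
    (hq : A₁ * X = q • (1 : Matrix κ₁ κ₁ S)) :
    Matrix.fromCols A₁ (t • (1 : Matrix κ₁ κ₁ S)) *
        Matrix.fromBlocks A₂ (Matrix.fromCols ((-t) • (1 : Matrix κ₂ κ₂ S)) X) 0
          (Matrix.fromCols A₁ (t • (1 : Matrix κ₁ κ₁ S))) =
      Matrix.fromCols 0 (Matrix.fromCols 0 ((q + t ^ 2) • 1)) := by
  rw [Matrix.fromCols_mul_fromBlocks, hA, Matrix.mul_fromCols, hq]
  ext I (J | J | J)
  · simp
  · simp
  · simp [Matrix.one_apply]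
    split_ifs <;> ring

/-- The induction step for `∂_i ∂_{i+1} = [O | qE]`, as an identity of block matrices. -/
lemma fromBlocks_mul_fromBlocks_eq [Fintype κ₂] [DecidableEq κ₂] [Fintype γ]
    [DecidableEq γ] {A₁ : Matrix κ₁ κ₂ S} {A₂ : Matrix κ₂ κ₃ S}
    {X : Matrix κ₂ κ₁ S} {Y : Matrix κ₁ κ₁ S} {t q : S} {T : Matrix κ₁ γ S}
    {g : Matrix γ (κ₁ ⊕ γ) S} (hA : A₁ * A₂ = 0) (hT : T * g = Matrix.fromCols Y ((-t) • T))
    (hq : A₁ * X + Y = (q - t ^ 2) • (1 : Matrix κ₁ κ₁ S))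
    (hg : g * Matrix.fromBlocks A₁ (Matrix.fromCols (t • (1 : Matrix κ₁ κ₁ S)) T) 0 g =
      Matrix.fromCols 0 (Matrix.fromCols 0 (q • 1))) :
    Matrix.fromBlocks A₁ (Matrix.fromCols (t • (1 : Matrix κ₁ κ₁ S)) T) 0 g *
        Matrix.fromBlocks A₂ (Matrix.fromCols ((-t) • (1 : Matrix κ₂ κ₂ S))
            (Matrix.fromCols X (0 : Matrix κ₂ γ S))) 0
          (Matrix.fromBlocks A₁ (Matrix.fromCols (t • (1 : Matrix κ₁ κ₁ S)) T) 0 g) =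
      Matrix.fromCols 0 (Matrix.fromCols 0 (q • 1)) := by
  rw [Matrix.fromBlocks_multiply, hg, hA, Matrix.fromCols_mul_fromBlocks, hT]
  ext (I | I) (J | J | J | J)
  · simp
  · simp
  · have := congrFun (congrFun hq I) J
    simp at this ⊢
    simp [Matrix.one_apply] at this ⊢
    split_ifs at this ⊢ <;> linear_combination this
  · simp
  · simp
  · simp
  · simp
  · simp [Matrix.one_apply]
end

/-- The composite of two consecutive rows `ᵗ∂^L` is zero because `L` is a complex. -/
lemma transpose_koszulMatrix_mul_transposeRow (x : Fin d → S) (i : ℕ) :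
    (koszulMatrix x (i + 1)).transpose * transposeRow x i = 0 := by
  have h (j) : (koszulMatrix x (j + 1)).transpose * (koszulMatrix x j).transpose = 0 := by
    rw [← Matrix.transpose_mul, koszulMatrix_mul_koszulMatrix, Matrix.transpose_zero]
  cases i with
  | zero => exact h 0
  | succ i =>
    refine (Matrix.mul_fromCols _ _ _).trans ?_
    rw [h, Matrix.mul_zero]
    exact Matrix.fromCols_zero

lemma transposeRow_mul_gMatrix (a x : Fin d → S) (b : S) (i : ℕ) :
    transposeRow x i * gMatrix a x b i =
      (Matrix.fromCols ((koszulMatrix x i).transpose * koszulMatrix a i)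
        (((-1) ^ i * b) • transposeRow x i) :
        Matrix (KoszulIndex d (i + 1)) (KoszulIndex d (i + 1) ⊕ GIndex d i) S) := by
  cases i with
  | zero =>
    refine (Matrix.mul_fromCols _ _ _).trans ?_
    refine congrArg₂ Matrix.fromCols rfl ?_
    refine (Matrix.mul_smul _ _ _).trans ?_
    rw [pow_zero, one_mul]
    exact congrArg _ (Matrix.mul_one _)
  | succ i => exact fromCols_one_mul_fromBlocks (transpose_koszulMatrix_mul_transposeRow x i)

/-- `∂_{i+1} ∂_{i+2}` is `b² + ∑ aⱼ xⱼ` times the projection `G_{i+2} → G_i`. -/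
theorem gMatrix_mul_gMatrix (a x : Fin d → S) (b : S) (i : ℕ) :
    gMatrix a x b i * gMatrix a x b (i + 1) =
      (Matrix.fromCols (0 : Matrix (GIndex d i) (KoszulIndex d (i + 2)) S)
        (Matrix.fromCols (0 : Matrix (GIndex d i) (KoszulIndex d (i + 1)) S)
          ((b ^ 2 + ∑ j, a j * x j) • (1 : Matrix (GIndex d i) (GIndex d i) S))) :
        Matrix (GIndex d i) (GIndex d (i + 2)) S) := by
  induction i with
  | zero =>
    have h := fromCols_mul_fromBlocks_eq (t := b) (koszulMatrix_mul_koszulMatrix a 0)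
      (koszulMatrix_zero_mul_transpose a x)
    have e : -b = (-1) ^ (0 + 1) * b := by ring
    rw [add_comm (∑ i, a i * x i), e] at h
    exact h
  | succ i ih =>
    have e : ∀ j : ℕ, (-1 : S) ^ (j + 1) * b = -((-1) ^ j * b) := fun j => by ring
    have hT := transposeRow_mul_gMatrix a x b i
    rw [← neg_neg ((-1) ^ i * b), ← e] at hT
    have hq : koszulMatrix a (i + 1) * (koszulMatrix x (i + 1)).transpose +
        (koszulMatrix x i).transpose * koszulMatrix a i =
        (b ^ 2 + ∑ j, a j * x j - ((-1) ^ (i + 1) * b) ^ 2) • 1 := by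
      rw [koszulMatrix_mul_transpose_add, mul_pow, ← pow_mul, mul_comm (i + 1), pow_mul]
      simp
    have h := fromBlocks_mul_fromBlocks_eq (koszulMatrix_mul_koszulMatrix a (i + 1)) hT hq ih
    rw [← e (i + 1)] at h
    exact h
end

/-! ### Depth sensitivity -/

open Matrix in
/-- Exactness of `Sⁿ → Sᵐ → Sˡ` at `Sᵐ` after reduction modulo `J`, where the maps are given by
`B` and `A`, phrased over `S`: a vector that `A` maps into `J` lies in the image of `B` up to a
vector with entries in `J`. The inclusion of the image in the kernel is not part of it. -/
def ExactMod {S : Type*} [CommRing S] {l m n : Type*} [Fintype m] [Fintype n] (J : Ideal S)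
    (A : Matrix l m S) (B : Matrix m n S) : Prop :=
  ∀ v : m → S, (∀ i, (A *ᵥ v) i ∈ J) → ∃ u : n → S, ∀ i, (v - B *ᵥ u) i ∈ J

section
open Matrix
variable {S : Type*} [CommRing S] {d : ℕ}

lemma mulVec_apply_mem {m n : Type*} [Fintype n] {J : Ideal S} (A : Matrix m n S) {v : n → S}
    (hv : ∀ i, v i ∈ J) (i : m) : (A *ᵥ v) i ∈ J :=
  J.sum_mem fun j _ => J.mul_mem_left _ (hv j)

lemma mulVec_apply_mem_of_matrix_mem {m n : Type*} [Fintype n] {J : Ideal S} {A : Matrix m n S}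
    (hA : ∀ i j, A i j ∈ J) (v : n → S) (i : m) : (A *ᵥ v) i ∈ J :=
  J.sum_mem fun j _ => J.mul_mem_right _ (hA i j)

lemma mem_of_mul_mem_of_isWeaklyRegular {rs : List S}
    (h : RingTheory.Sequence.IsWeaklyRegular S rs) {i : ℕ} (hi : i < rs.length) {s : S}
    (hs : rs[i] * s ∈ Ideal.ofList (rs.take i)) : s ∈ Ideal.ofList (rs.take i) := by
  have := h.regular_mod_prev i hi
  rw [isSMulRegular_quotient_iff_mem_of_smul_mem] at this
  simpa using this s (by simpa using hs)

/-- Depth sensitivity. Let `D` be a complex of finite free modules in degrees `0, …, n`, and let `rs`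
be a weakly regular sequence of elements that have a power homotopic to zero on `D`. Modulo the
first `i` elements of `rs`, with `k` elements left, `D` is exact in all degrees above `n - k`.
If `r` is the next element and `D` is exact in degree `j + 2` modulo one more element, then `r` acts
injectively on the homology in degree `j + 1`; as a power of `r` kills it, this homology is zero. -/
theorem exactMod_of_isWeaklyRegular {ι : ℕ → Type*} [∀ i, Fintype (ι i)] [∀ i, DecidableEq (ι i)]
    (D : ∀ i, Matrix (ι i) (ι (i + 1)) S) (hD : ∀ i, D i * D (i + 1) = 0) {n : ℕ}
    (hn : ∀ i, n < i → IsEmpty (ι i)) {rs : List S}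
    (hreg : RingTheory.Sequence.IsWeaklyRegular S rs)
    (hrs : ∀ r ∈ rs, ∃ (N : ℕ) (H : ∀ i, Matrix (ι (i + 1)) (ι i) S),
      ∀ i, D (i + 1) * H (i + 1) + H i * D i = r ^ N • 1) (k : ℕ) :
    ∀ i j, i + k = rs.length → n < j + 1 + k →
      ExactMod (Ideal.ofList (rs.take i)) (D j) (D (j + 1)) := by
  induction k with
  | zero =>
    intro i j _ hj v _
    have := hn _ hj
    exact ⟨0, fun i => isEmptyElim i⟩
  | succ k ih =>
    intro i j hi hj v hv
    have hi' : i < rs.length := by omega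
    set r := rs[i]
    set J := Ideal.ofList (rs.take i)
    have hJ : ∀ s : S, s ∈ Ideal.ofList (rs.take (i + 1)) ↔ ∃ t, s - r * t ∈ J := fun s => by
      rw [← List.take_concat_get' _ _ hi', Ideal.ofList_append, Ideal.ofList_singleton, sup_comm,
        Submodule.mem_sup]
      constructor
      · rintro ⟨y, hy, z, hz, rfl⟩
        obtain ⟨t, rfl⟩ := Ideal.mem_span_singleton'.1 hy
        exact ⟨t, by simpa [r, mul_comm] using hz⟩
      · rintro ⟨t, ht⟩
        exact ⟨r * t, Ideal.mul_mem_right _ _ (Ideal.mem_span_singleton_self _), _, ht, by ring⟩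
    -- `r` is injective on homology
    have step : ∀ z : ι (j + 1) → S, (∃ w, ∀ p, (r • z - D (j + 1) *ᵥ w) p ∈ J) →
        ∃ u, ∀ p, (z - D (j + 1) *ᵥ u) p ∈ J := by
      rintro z ⟨w, hw⟩
      -- `w` is a cycle modulo `J + (r)`
      obtain ⟨u, hu⟩ := ih (i + 1) (j + 1) (by omega) (by omega) w fun p => by
        refine (hJ _).2 ⟨z p, ?_⟩
        have := J.neg_mem (hw p)
        simpa using this
      choose t ht using fun p => (hJ _).1 (hu p)
      refine ⟨t, fun p => mem_of_mul_mem_of_isWeaklyRegular hreg hi' ?_⟩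
      have h1 := mulVec_apply_mem (D (j + 1)) ht p
      have h2 : (fun p => (w - D (j + 1 + 1) *ᵥ u) p - r * t p)
          = w - D (j + 1 + 1) *ᵥ u - r • t := rfl
      rw [h2, mulVec_sub, mulVec_sub, mulVec_mulVec, hD, zero_mulVec, mulVec_smul] at h1
      have h3 := J.add_mem (hw p) h1
      convert h3 using 1
      simp [r]
      ring
    obtain ⟨N, H, hH⟩ := hrs r (List.getElem_mem hi')
    have key : ∀ N : ℕ, (∃ w, ∀ p, (r ^ N • v - D (j + 1) *ᵥ w) p ∈ J) →
        ∃ u, ∀ p, (v - D (j + 1) *ᵥ u) p ∈ J := by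
      intro N
      induction N with
      | zero => simp
      | succ N ihN =>
        intro h
        refine ihN (step _ ?_)
        rwa [smul_smul, ← pow_succ']
    refine key N ⟨H (j + 1) *ᵥ v, fun p => ?_⟩
    have h1 := congrArg (· *ᵥ v) (hH j)
    simp only [add_mulVec, smul_mulVec, one_mulVec, ← mulVec_mulVec] at h1
    rw [← h1, add_sub_cancel_left]
    exact mulVec_apply_mem _ hv p

/-! ### The Koszul complex of `a, b` -/

/-- The index set of the standard basis of `C_i`, where `C_0 = K_0` and `C_{i+1} = K_{i+1} ⊕ K_i`. -/
def ConeIndex (d : ℕ) : ℕ → Type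
  | 0 => KoszulIndex d 0
  | i + 1 => KoszulIndex d (i + 1) ⊕ KoszulIndex d i

instance ConeIndex.instFintype (d : ℕ) : (i : ℕ) → Fintype (ConeIndex d i)
  | 0 => inferInstanceAs (Fintype (KoszulIndex d 0))
  | i + 1 => inferInstanceAs (Fintype (KoszulIndex d (i + 1) ⊕ KoszulIndex d i))

instance ConeIndex.instDecidableEq (d : ℕ) : (i : ℕ) → DecidableEq (ConeIndex d i)
  | 0 => inferInstanceAs (DecidableEq (KoszulIndex d 0))
  | i + 1 => inferInstanceAs (DecidableEq (KoszulIndex d (i + 1) ⊕ KoszulIndex d i))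

/-- The differential `C_{i+1} → C_i` of the mapping cone of multiplication by `b` on the Koszul
complex of `a`, which is the Koszul complex of `a, b`. -/
def coneMatrix (a : Fin d → S) (b : S) : (i : ℕ) → Matrix (ConeIndex d i) (ConeIndex d (i + 1)) S
  | 0 => fromCols (koszulMatrix a 0) (b • (1 : Matrix (KoszulIndex d 0) (KoszulIndex d 0) S))
  | i + 1 => fromBlocks (koszulMatrix a (i + 1))
      (((-1) ^ (i + 1) * b) • (1 : Matrix (KoszulIndex d (i + 1)) (KoszulIndex d (i + 1)) S)) 0
      (koszulMatrix a i)

/-- The homotopy on the cone for multiplication by `∑ aⱼ cⱼ + b e`; see `coneMatrix_homotopy`. -/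
def coneHomotopy (c : Fin d → S) (e : S) :
    (i : ℕ) → Matrix (ConeIndex d (i + 1)) (ConeIndex d i) S
  | 0 => fromRows (koszulMatrix c 0)ᵀ (e • (1 : Matrix (KoszulIndex d 0) (KoszulIndex d 0) S))
  | i + 1 => fromBlocks (koszulMatrix c (i + 1))ᵀ 0
      (((-1) ^ (i + 1) * e) • (1 : Matrix (KoszulIndex d (i + 1)) (KoszulIndex d (i + 1)) S))
      (koszulMatrix c i)ᵀ

section
variable {κ₀ κ₁ κ₂ κ₃ : Type*} [Fintype κ₁] [DecidableEq κ₁]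

lemma fromCols_mul_fromBlocks_eq_zero [Fintype κ₀] [DecidableEq κ₀]
    {A₀ : Matrix κ₀ κ₁ S} {A₁ : Matrix κ₁ κ₂ S} {t : S} (h : A₀ * A₁ = 0) :
    fromCols A₀ (t • (1 : Matrix κ₀ κ₀ S)) *
      fromBlocks A₁ ((-t) • (1 : Matrix κ₁ κ₁ S)) 0 A₀ = 0 := by
  rw [fromCols_mul_fromBlocks, h]
  ext _ (_ | _) <;> simp

lemma fromBlocks_mul_fromBlocks_eq_zero [Fintype κ₂] [DecidableEq κ₂]
    {A₀ : Matrix κ₀ κ₁ S} {A₁ : Matrix κ₁ κ₂ S} {A₂ : Matrix κ₂ κ₃ S} {t : S} (h : A₀ * A₁ = 0)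
    (h' : A₁ * A₂ = 0) :
    fromBlocks A₁ (t • (1 : Matrix κ₁ κ₁ S)) 0 A₀ *
      fromBlocks A₂ ((-t) • (1 : Matrix κ₂ κ₂ S)) 0 A₁ = 0 := by
  rw [fromBlocks_multiply, h, h']
  ext (_ | _) (_ | _) <;> simp

lemma fromBlocks_homotopy_zero [Fintype κ₀] [DecidableEq κ₀] [Fintype κ₂]
    {A₀ : Matrix κ₀ κ₁ S} {A₁ : Matrix κ₁ κ₂ S}
    {X₀ : Matrix κ₁ κ₀ S} {X₁ : Matrix κ₂ κ₁ S} {b e q : S}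
    (h₀ : A₀ * X₀ = q • (1 : Matrix κ₀ κ₀ S)) (h₁ : A₁ * X₁ + X₀ * A₀ = q • (1 : Matrix κ₁ κ₁ S)) :
    fromBlocks A₁ ((-b) • (1 : Matrix κ₁ κ₁ S)) 0 A₀ *
        fromBlocks X₁ 0 ((-e) • (1 : Matrix κ₁ κ₁ S)) X₀ +
      fromRows X₀ (e • (1 : Matrix κ₀ κ₀ S)) * fromCols A₀ (b • (1 : Matrix κ₀ κ₀ S)) =
      (q + b * e) • 1 := by
  rw [fromBlocks_multiply, fromRows_mul_fromCols, h₀]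
  ext (I | I) (J | J)
  · have := congrFun (congrFun h₁ I) J
    simp [one_apply] at this ⊢
    split_ifs at this ⊢ <;> linear_combination this
  · simp
  · simp
  · simp [one_apply]
    split_ifs <;> ring

lemma fromBlocks_homotopy [Fintype κ₀] [DecidableEq κ₀] [Fintype κ₂] [DecidableEq κ₂] [Fintype κ₃]
    {A₀ : Matrix κ₀ κ₁ S} {A₁ : Matrix κ₁ κ₂ S} {A₂ : Matrix κ₂ κ₃ S}
    {X₀ : Matrix κ₁ κ₀ S} {X₁ : Matrix κ₂ κ₁ S} {X₂ : Matrix κ₃ κ₂ S} {t u q : S}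
    (h₁ : A₁ * X₁ + X₀ * A₀ = q • (1 : Matrix κ₁ κ₁ S))
    (h₂ : A₂ * X₂ + X₁ * A₁ = q • (1 : Matrix κ₂ κ₂ S)) :
    fromBlocks A₂ ((-t) • (1 : Matrix κ₂ κ₂ S)) 0 A₁ *
        fromBlocks X₂ 0 ((-u) • (1 : Matrix κ₂ κ₂ S)) X₁ +
      fromBlocks X₁ 0 (u • (1 : Matrix κ₁ κ₁ S)) X₀ *
        fromBlocks A₁ (t • (1 : Matrix κ₁ κ₁ S)) 0 A₀ =
      (q + t * u) • 1 := by
  rw [fromBlocks_multiply, fromBlocks_multiply]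
  ext (I | I) (J | J)
  · have := congrFun (congrFun h₂ I) J
    simp [one_apply] at this ⊢
    split_ifs at this ⊢ <;> linear_combination this
  · simp
  · simp
  · have := congrFun (congrFun h₁ I) J
    simp [one_apply] at this ⊢
    split_ifs at this ⊢ <;> linear_combination this
end

lemma coneMatrix_mul_coneMatrix (a : Fin d → S) (b : S) (i : ℕ) :
    coneMatrix a b i * coneMatrix a b (i + 1) = 0 := by
  cases i with
  | zero =>
    have h := fromCols_mul_fromBlocks_eq_zero (t := b) (koszulMatrix_mul_koszulMatrix a 0)
    have e : -b = (-1) ^ (0 + 1) * b := by ring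
    rw [e] at h
    exact h
  | succ i =>
    have h := fromBlocks_mul_fromBlocks_eq_zero (t := (-1) ^ (i + 1) * b)
      (koszulMatrix_mul_koszulMatrix a i) (koszulMatrix_mul_koszulMatrix a (i + 1))
    have e : -((-1) ^ (i + 1) * b) = (-1) ^ (i + 1 + 1) * b := by ring
    rw [e] at h
    exact h

lemma coneMatrix_homotopy (a c : Fin d → S) (b e : S) (i : ℕ) :
    coneMatrix a b (i + 1) * coneHomotopy c e (i + 1) + coneHomotopy c e i * coneMatrix a b i =
      (∑ j, a j * c j + b * e) • 1 := by
  cases i with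
  | zero =>
    have h := fromBlocks_homotopy_zero (b := b) (e := e) (koszulMatrix_zero_mul_transpose a c)
      (koszulMatrix_mul_transpose_add a c 0)
    have e' (b : S) : -b = (-1) ^ (0 + 1) * b := by ring
    rw [e' b, e' e] at h
    exact h
  | succ i =>
    have h := fromBlocks_homotopy (t := (-1) ^ (i + 1) * b) (u := (-1) ^ (i + 1) * e)
      (koszulMatrix_mul_transpose_add a c i) (koszulMatrix_mul_transpose_add a c (i + 1))
    have e' (b : S) : -((-1) ^ (i + 1) * b) = (-1) ^ (i + 1 + 1) * b := by ring
    have hs : ((-1) ^ (i + 1) * b) * ((-1) ^ (i + 1) * e) = b * e := by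
      rw [mul_mul_mul_comm, ← pow_add, Even.neg_one_pow ⟨_, rfl⟩, one_mul]
    rw [e' b, e', hs] at h
    exact h

end

section
open Matrix
variable {S : Type*} [CommRing S] {d : ℕ}

/-! ### Acyclicity of the Koszul complex of `a` -/

lemma exactMod_bot_iff {l m n : Type*} [Fintype m] [Fintype n] {A : Matrix l m S}
    {B : Matrix m n S} : ExactMod ⊥ A B ↔ ∀ v, A *ᵥ v = 0 → ∃ u, B *ᵥ u = v := by
  refine forall_congr' fun v => imp_congr ?_ (exists_congr fun u => ?_)
  · simp [funext_iff]
  · simp [funext_iff, sub_eq_zero, eq_comm]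

lemma koszulMatrix_apply_mem {J : Ideal S} {a : Fin d → S} (ha : ∀ i, a i ∈ J) {p : ℕ}
    (I : KoszulIndex d p) (I' : KoszulIndex d (p + 1)) : koszulMatrix a p I I' ∈ J := by
  refine J.sum_mem fun j _ => ?_
  split_ifs
  · exact J.mul_mem_left _ (ha j)
  · exact J.zero_mem

lemma koszulMatrix_mulVec_mem (a : Fin d → S) (v : KoszulIndex d 1 → S) (I : KoszulIndex d 0) :
    (koszulMatrix a 0 *ᵥ v) I ∈ Ideal.span (Set.range a) :=
  mulVec_apply_mem_of_matrix_mem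
    (koszulMatrix_apply_mem fun i => Ideal.subset_span (Set.mem_range_self i)) v I

lemma exists_koszulMatrix_mulVec_eq {a : Fin d → S} {s : S} (hs : s ∈ Ideal.span (Set.range a)) :
    ∃ v, koszulMatrix a 0 *ᵥ v = fun _ => s := by
  obtain ⟨c, rfl⟩ := Ideal.mem_span_range_iff_exists_fun.1 hs
  -- the homotopy given by the coefficients `c`, applied to `1`
  refine ⟨(koszulMatrix c 0)ᵀ *ᵥ fun _ => 1, ?_⟩
  rw [mulVec_mulVec, koszulMatrix_zero_mul_transpose, smul_mulVec, one_mulVec]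
  ext
  simp [mul_comm]

/-- The only index in degree `0` is the empty set. -/
instance KoszulIndex.instUniqueZero : Unique (KoszulIndex d 0) where
  default := ⟨∅, Finset.card_empty⟩
  uniq I := Subtype.ext (Finset.card_eq_zero.1 I.2)

lemma fromCols_smul_one_mulVec {l m : Type*} [Fintype l] [Fintype m] [DecidableEq l]
    (A : Matrix l m S) (b : S) (v : m → S) (w : l → S) :
    fromCols A (b • (1 : Matrix l l S)) *ᵥ Sum.elim v w = A *ᵥ v + b • w := by
  rw [fromCols_mulVec_sumElim, smul_mulVec, one_mulVec]

lemma coneMatrix_zero_mulVec (a : Fin d → S) (b : S) (v : KoszulIndex d 1 → S)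
    (w : KoszulIndex d 0 → S) :
    coneMatrix a b 0 *ᵥ Sum.elim v w = koszulMatrix a 0 *ᵥ v + b • w :=
  fromCols_smul_one_mulVec _ _ _ _

lemma coneMatrix_succ_mulVec (a : Fin d → S) (b : S) (i : ℕ) (v : KoszulIndex d (i + 2) → S)
    (w : KoszulIndex d (i + 1) → S) :
    coneMatrix a b (i + 1) *ᵥ Sum.elim v w =
      (Sum.elim (koszulMatrix a (i + 1) *ᵥ v + ((-1) ^ (i + 1) * b) • w) (koszulMatrix a i *ᵥ w) :
        KoszulIndex d (i + 1) ⊕ KoszulIndex d i → S) := by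
  refine (fromBlocks_mulVec _ _ _ _ _).trans ?_
  rw [smul_mulVec, one_mulVec, zero_mulVec, zero_add]
  rfl

lemma exists_of_coneMatrix_exact {a : Fin d → S} {b : S} {i : ℕ}
    (h : ExactMod ⊥ (coneMatrix a b i) (coneMatrix a b (i + 1)))
    {v : KoszulIndex d (i + 1) → S} {w : KoszulIndex d i → S}
    (hvw : coneMatrix a b i *ᵥ (Sum.elim v w : KoszulIndex d (i + 1) ⊕ KoszulIndex d i → S) = 0) :
    ∃ v' w', koszulMatrix a (i + 1) *ᵥ v' + ((-1) ^ (i + 1) * b) • w' = v ∧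
      koszulMatrix a i *ᵥ w' = w := by
  obtain ⟨u, hu⟩ := exactMod_bot_iff.1 h _ hvw
  refine ⟨u ∘ Sum.inl, u ∘ Sum.inr, ?_⟩
  have h1 := (coneMatrix_succ_mulVec a b i (u ∘ Sum.inl) (u ∘ Sum.inr)).symm.trans
    ((congrArg (coneMatrix a b (i + 1) *ᵥ ·) (Sum.elim_comp_inl_inr u)).trans hu)
  exact ⟨funext fun p => congrFun h1 (Sum.inl p), funext fun p => congrFun h1 (Sum.inr p)⟩

/-- Exactness of the cone in degree `1` says that `b` is regular modulo `a`. -/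
lemma mem_of_mul_mem_of_coneMatrix_exact {a : Fin d → S} {b : S}
    (h : ExactMod ⊥ (coneMatrix a b 0) (coneMatrix a b 1)) {s : S}
    (hs : b * s ∈ Ideal.span (Set.range a)) : s ∈ Ideal.span (Set.range a) := by
  obtain ⟨c, hc⟩ := exists_koszulMatrix_mulVec_eq hs
  obtain ⟨_, w, -, hw⟩ := exists_of_coneMatrix_exact h (v := -c) (w := fun _ => s) (by
    refine (coneMatrix_zero_mulVec _ _ _ _).trans ?_
    rw [mulVec_neg, hc]
    exact neg_add_cancel (b • fun _ => s))
  have := koszulMatrix_mulVec_mem a w default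
  rwa [hw] at this

/-- If the Koszul complex of `a, b` is exact in positive degrees, then so is that of `a`: since `b`
acts surjectively on the homology of the latter, Nakayama's lemma applies. -/
lemma koszulMatrix_exact [IsNoetherianRing S] [IsLocalRing S] {a : Fin d → S} {b : S}
    (hb : b ∈ IsLocalRing.maximalIdeal S)
    (h : ∀ j, ExactMod ⊥ (coneMatrix a b j) (coneMatrix a b (j + 1))) (j : ℕ) :
    ExactMod ⊥ (koszulMatrix a j) (koszulMatrix a (j + 1)) := by
  have key : ∀ z, koszulMatrix a j *ᵥ z = 0 →
      ∃ k l, koszulMatrix a j *ᵥ l = 0 ∧ koszulMatrix a (j + 1) *ᵥ k + b • l = z := by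
    intro z hz
    obtain ⟨k, l, h1, h2⟩ := exists_of_coneMatrix_exact (h j) (v := z) (w := 0) (by
      cases j with
      | zero =>
        refine (coneMatrix_zero_mulVec _ _ _ _).trans ?_
        rw [hz, smul_zero, add_zero]
        rfl
      | succ j =>
        refine (coneMatrix_succ_mulVec _ _ _ _ _).trans ?_
        rw [hz, smul_zero, add_zero, mulVec_zero]
        exact Sum.elim_zero_zero)
    refine ⟨k, ((-1) ^ (j + 1) : S) • l, by rw [mulVec_smul, h2, smul_zero], ?_⟩
    rw [← h1, smul_smul, mul_comm b]
  rw [exactMod_bot_iff]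
  have hle : LinearMap.ker (koszulMatrix a j).mulVecLin ≤
      LinearMap.range (koszulMatrix a (j + 1)).mulVecLin := by
    refine Submodule.le_of_le_smul_of_le_jacobson_bot (I := Ideal.span {b})
      (IsNoetherian.noetherian _) ?_ ?_
    · rw [Ideal.span_le, Set.singleton_subset_iff]
      exact IsLocalRing.maximalIdeal_le_jacobson _ hb
    · intro z hz
      obtain ⟨k, l, hl, rfl⟩ := key z hz
      exact Submodule.add_mem_sup ⟨k, rfl⟩
        (Submodule.smul_mem_smul (Ideal.mem_span_singleton_self b) hl)
  exact fun v hv => hle hv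

/-- The Koszul complex of `a` stays exact modulo `f` if `f` is regular on `S` and modulo `a`. -/
lemma koszulMatrix_exactMod_span_singleton {a : Fin d → S} {f : S} (hf : f ∈ nonZeroDivisors S)
    (hfa : ∀ s, f * s ∈ Ideal.span (Set.range a) → s ∈ Ideal.span (Set.range a))
    (h : ∀ j, ExactMod ⊥ (koszulMatrix a j) (koszulMatrix a (j + 1))) (j : ℕ) :
    ExactMod (Ideal.span {f}) (koszulMatrix a j) (koszulMatrix a (j + 1)) := by
  intro v hv
  choose w hw using fun i => Ideal.mem_span_singleton'.1 (hv i)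
  have hw' : koszulMatrix a j *ᵥ v = f • w := by
    ext i
    simp [← hw i, mul_comm]
  -- `f w` is a boundary, so `w` is a cycle, or lies in `(a)` if `j = 0`
  obtain ⟨c, hc⟩ : ∃ c, koszulMatrix a j *ᵥ c = w := by
    cases j with
    | zero =>
      obtain ⟨c, hc⟩ := exists_koszulMatrix_mulVec_eq (a := a) (s := w default) (hfa _ (by
        rw [← smul_eq_mul, ← Pi.smul_apply, ← hw']
        exact koszulMatrix_mulVec_mem _ _ _))
      exact ⟨c, by rw [hc]; ext i; rw [Subsingleton.elim i default]⟩
    | succ j =>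
      refine exactMod_bot_iff.1 (h j) w ?_
      have h1 : f • (koszulMatrix a j *ᵥ w) = 0 := by
        rw [← mulVec_smul, ← hw', mulVec_mulVec, koszulMatrix_mul_koszulMatrix, zero_mulVec]
      ext i
      exact (mul_left_mem_nonZeroDivisors_eq_zero_iff hf).1 (congrFun h1 i)
  obtain ⟨u, hu⟩ := exactMod_bot_iff.1 (h j) (v - f • c) (by
    rw [mulVec_sub, mulVec_smul, hc, hw', sub_self])
  refine ⟨u, fun i => ?_⟩
  rw [hu]
  simpa using Ideal.mul_mem_right _ _ (Ideal.mem_span_singleton_self f)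

/-! ### Exactness of `G` modulo `f` -/

/-- Exactness of an extension: `A₁` continues `A₀` exactly on the first summand, and by `hg` the
second component of every cycle is, modulo `J`, in the image of `g`. -/
lemma exactMod_fromBlocks {l κ₀ κ₁ κ₂ γ₀ γ₁ : Type*} [Fintype κ₁] [Fintype κ₂] [Fintype γ₀]
    [Fintype γ₁] {J : Ideal S} {A₀ : Matrix κ₀ κ₁ S} {A₁ : Matrix κ₁ κ₂ S} (hA : ExactMod J A₀ A₁)
    {B : Matrix κ₁ γ₁ S} {g : Matrix γ₀ γ₁ S} {P : Matrix l (κ₁ ⊕ γ₀) S}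
    (hP : ∀ k : κ₁ → S, (∀ i, (P *ᵥ Sum.elim k 0) i ∈ J) → ∀ i, (A₀ *ᵥ k) i ∈ J)
    (hPg : ∀ i j, (P * fromBlocks A₁ B 0 g) i j ∈ J)
    (hg : ∀ v, (∀ i, (P *ᵥ v) i ∈ J) → ∃ y, ∀ i, (v (Sum.inr i) - (g *ᵥ y) i) ∈ J) :
    ExactMod J P (fromBlocks A₁ B 0 g) := by
  intro v hv
  obtain ⟨y, hy⟩ := hg v hv
  -- the first component of `v - ∂(0, y)`
  set k : κ₁ → S := v ∘ Sum.inl - B *ᵥ y with hk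
  obtain ⟨c, hc⟩ := hA k (hP k fun i => by
    have h1 : (Sum.elim k 0 : κ₁ ⊕ γ₀ → S) = v - fromBlocks A₁ B 0 g *ᵥ Sum.elim 0 y -
        Sum.elim (0 : κ₁ → S) (v ∘ Sum.inr - g *ᵥ y) := by
      rw [fromBlocks_mulVec]
      ext (_ | _) <;> simp [hk]
    rw [h1, mulVec_sub, mulVec_sub, mulVec_mulVec]
    refine J.sub_mem (J.sub_mem (hv i) (mulVec_apply_mem_of_matrix_mem hPg _ i)) ?_
    refine mulVec_apply_mem P ?_ i
    rintro (j | j)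
    · simp
    · exact hy j)
  refine ⟨Sum.elim c y, ?_⟩
  rw [fromBlocks_mulVec]
  rintro (i | i)
  · have := hc i
    simp only [hk, Pi.sub_apply, Function.comp_apply] at this
    simp only [Sum.elim_comp_inl, Sum.elim_comp_inr, Pi.sub_apply, Sum.elim_inl, Pi.add_apply]
    convert this using 1
    ring
  · simpa using hy i

lemma gMatrix_zero_mulVec (a x : Fin d → S) (b : S) (v : KoszulIndex d 1 ⊕ KoszulIndex d 0 → S)
    (p : KoszulIndex d 0) :
    (gMatrix a x b 0 *ᵥ v) p = (koszulMatrix a 0 *ᵥ (v ∘ Sum.inl)) p + b * v (Sum.inr p) := by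
  have h := fromCols_smul_one_mulVec (koszulMatrix a 0) b (v ∘ Sum.inl) (v ∘ Sum.inr)
  rw [Sum.elim_comp_inl_inr] at h
  exact congrFun h p

lemma gMatrix_succ_mulVec_inl (a x : Fin d → S) (b : S) (i : ℕ) (v : KoszulIndex d (i + 2) → S)
    (p : KoszulIndex d (i + 1)) :
    (gMatrix a x b (i + 1) *ᵥ (Sum.elim v 0 : KoszulIndex d (i + 2) ⊕ GIndex d (i + 1) → S))
      (Sum.inl p) = (koszulMatrix a (i + 1) *ᵥ v) p := by
  refine (congrFun (fromBlocks_mulVec _ _ _ _ _) (Sum.inl p)).trans ?_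
  refine (congrArg ((koszulMatrix a (i + 1) *ᵥ v) p + ·) (congrFun (mulVec_zero _) p)).trans ?_
  exact add_zero _

lemma gMatrix_succ_mulVec_inr (a x : Fin d → S) (b : S) (i : ℕ)
    (v : KoszulIndex d (i + 2) ⊕ GIndex d (i + 1) → S) (p : GIndex d i) :
    (gMatrix a x b (i + 1) *ᵥ v) (Sum.inr p) = (gMatrix a x b i *ᵥ (v ∘ Sum.inr)) p := by
  refine (congrFun (fromBlocks_mulVec _ _ _ _ _) (Sum.inr p)).trans ?_
  refine (congrArg (· + (gMatrix a x b i *ᵥ (v ∘ Sum.inr)) p)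
    (congrFun (zero_mulVec _) p)).trans ?_
  exact zero_add _

lemma exists_gMatrix_zero_mulVec_eq {a : Fin d → S} (x : Fin d → S) {b s : S}
    (hs : s ∈ Ideal.span (insert b (Set.range a))) :
    ∃ y, ∀ p : KoszulIndex d 0, (gMatrix a x b 0 *ᵥ y) p = s := by
  obtain ⟨t, z, hz, rfl⟩ := Ideal.mem_span_insert.1 hs
  obtain ⟨c, hc⟩ := exists_koszulMatrix_mulVec_eq hz
  let y : KoszulIndex d 1 ⊕ KoszulIndex d 0 → S := Sum.elim c fun _ => t
  refine ⟨y, fun p => (gMatrix_zero_mulVec _ _ _ _ _).trans ?_⟩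
  rw [Sum.elim_comp_inl, hc]
  exact (add_comm _ _).trans (congrArg (· + z) (mul_comm b t))

lemma exists_of_gMatrix_zero_mulVec_mem {J : Ideal S} {a x : Fin d → S} {b : S}
    (hb : ∀ s, b * s ∈ J ⊔ Ideal.span (Set.range a) → s ∈ Ideal.span (insert b (Set.range a)))
    (v : KoszulIndex d 1 ⊕ KoszulIndex d 0 → S)
    (hv : ∀ p : KoszulIndex d 0, (gMatrix a x b 0 *ᵥ v) p ∈ J) :
    ∃ y, ∀ p : KoszulIndex d 0, v (Sum.inr p) - (gMatrix a x b 0 *ᵥ y) p ∈ J := by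
  have h1 := hv default
  rw [gMatrix_zero_mulVec] at h1
  have h2 := koszulMatrix_mulVec_mem a (v ∘ Sum.inl) default
  have h3 := Ideal.sub_mem _ (Ideal.mem_sup_left h1) (Ideal.mem_sup_right h2)
  rw [add_sub_cancel_left] at h3
  obtain ⟨y, hy⟩ := exists_gMatrix_zero_mulVec_eq x (hb _ h3)
  refine ⟨y, fun p => ?_⟩
  rw [hy, Subsingleton.elim p default, sub_self]
  exact J.zero_mem

/-- Exactness of `G` modulo `J`, by induction along `0 → K → G → G[-1] → 0`. In degree `0` the
connecting map is `b : S/(J + (a, b)) → S/(J + (a))`, and `hb` implies that it is injective. -/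
lemma gMatrix_exactMod {J : Ideal S} {a x : Fin d → S} {b : S}
    (hJ : b ^ 2 + ∑ i, a i * x i ∈ J)
    (hb : ∀ s, b * s ∈ J ⊔ Ideal.span (Set.range a) → s ∈ Ideal.span (insert b (Set.range a)))
    (hK : ∀ j, ExactMod J (koszulMatrix a j) (koszulMatrix a (j + 1))) (i : ℕ) :
    ExactMod J (gMatrix a x b i) (gMatrix a x b (i + 1)) := by
  have hcomp : ∀ i p q, (gMatrix a x b i * gMatrix a x b (i + 1)) p q ∈ J := by
    intro i p q
    rw [gMatrix_mul_gMatrix]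
    rcases q with q | q | q
    · exact J.zero_mem
    · exact J.zero_mem
    · exact J.mul_mem_right _ hJ
  induction i with
  | zero =>
    refine exactMod_fromBlocks (hK 0) ?_ (hcomp 0) ?_
    · intro k hk i
      have := (congrArg (· ∈ J) (gMatrix_zero_mulVec a x b (Sum.elim k 0) i)).mp (hk i)
      rwa [Sum.elim_comp_inl, Sum.elim_inr, Pi.zero_apply, mul_zero, add_zero] at this
    · exact exists_of_gMatrix_zero_mulVec_mem hb
  | succ i ih =>
    refine exactMod_fromBlocks (hK (i + 1)) ?_ (hcomp (i + 1)) ?_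
    · intro k hk p
      exact (congrArg (· ∈ J) (gMatrix_succ_mulVec_inl a x b i k p)).mp (hk (Sum.inl p))
    · intro v hv
      refine ih (v ∘ Sum.inr) fun p => ?_
      exact (congrArg (· ∈ J) (gMatrix_succ_mulVec_inr a x b i v p)).mp (hv (Sum.inr p))

/-! ### Passage to `R = S/(f)` -/

lemma exact_mulVecLin_map_mk {l m n : Type*} [Fintype m] [Fintype n]
    {J : Ideal S} {A : Matrix l m S} {B : Matrix m n S} (h : ExactMod J A B)
    (hAB : ∀ i j, (A * B) i j ∈ J) :
    Function.Exact (B.map (Ideal.Quotient.mk J)).mulVecLin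
      (A.map (Ideal.Quotient.mk J)).mulVecLin := by
  intro v
  constructor
  · intro hv
    obtain ⟨w, rfl⟩ : ∃ w : m → S, Ideal.Quotient.mk J ∘ w = v :=
      Ideal.Quotient.mk_surjective.comp_left v
    obtain ⟨u, hu⟩ := h w fun i => by
      rw [← Ideal.Quotient.eq_zero_iff_mem, RingHom.map_mulVec]
      exact congrFun hv i
    refine ⟨Ideal.Quotient.mk J ∘ u, ?_⟩
    ext i
    rw [mulVecLin_apply, ← RingHom.map_mulVec]
    exact (Ideal.Quotient.eq.2 (hu i)).symm
  · rintro ⟨u, rfl⟩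
    rw [mulVecLin_apply, mulVecLin_apply, mulVec_mulVec, ← Matrix.map_mul]
    ext i
    exact Finset.sum_eq_zero fun j _ => mul_eq_zero_of_left
      (Ideal.Quotient.eq_zero_iff_mem.2 (hAB i j)) _

lemma mem_smul_top_of_forall_mem {R ι : Type*} [CommRing R] [Fintype ι] {J : Ideal R} {w : ι → R}
    (hw : ∀ i, w i ∈ J) : w ∈ J • (⊤ : Submodule R (ι → R)) := by
  classical
  rw [pi_eq_sum_univ' w]
  exact Submodule.sum_mem _ fun i _ => Submodule.smul_mem_smul (hw i) trivial

lemma transposeRow_apply_mem {J : Ideal S} {x : Fin d → S} (hx : ∀ i, x i ∈ J) {i : ℕ}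
    (p : KoszulIndex d (i + 1)) (q : GIndex d i) : transposeRow x i p q ∈ J := by
  cases i with
  | zero => exact koszulMatrix_apply_mem hx _ _
  | succ i =>
    rcases q with q | q
    · exact koszulMatrix_apply_mem hx _ _
    · exact J.zero_mem

lemma gMatrix_apply_mem {J : Ideal S} {a x : Fin d → S} {b : S} (ha : ∀ i, a i ∈ J)
    (hx : ∀ i, x i ∈ J) (hb : b ∈ J) {i : ℕ} (p : GIndex d i) (q : GIndex d (i + 1)) :
    gMatrix a x b i p q ∈ J := by
  induction i with
  | zero =>
    rcases q with q | q
    · exact koszulMatrix_apply_mem ha _ _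
    · exact J.mul_mem_right _ hb
  | succ i ih =>
    rcases p with p | p <;> rcases q with q | q
    · exact koszulMatrix_apply_mem ha _ _
    · rcases q with q | q
      · exact J.mul_mem_right _ (J.mul_mem_left _ hb)
      · exact transposeRow_apply_mem hx _ _
    · exact J.zero_mem
    · exact ih _ _

/-! ### Stabilization of `G` -/

lemma KoszulIndex.isEmpty_of_lt {p : ℕ} (hp : d < p) : IsEmpty (KoszulIndex d p) := ⟨fun I => by
  have := I.1.card_le_univ
  rw [I.2, Fintype.card_fin] at this
  omega⟩

lemma GIndex.incl_bijective (k : ℕ) : Function.Bijective (GIndex.incl d d k) := by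
  induction k with
  | zero => exact Function.bijective_id
  | succ k ih =>
    have : IsEmpty (KoszulIndex d (d + k + 1)) := KoszulIndex.isEmpty_of_lt (by omega)
    refine Function.Bijective.comp (g := Sum.inr) ⟨Sum.inr_injective, ?_⟩ ih
    rintro (q | q)
    · exact isEmptyElim q
    · exact ⟨q, rfl⟩

lemma gMatrix_submatrix_incl (a x : Fin d → S) (b : S) (i k : ℕ) :
    (gMatrix a x b (i + k)).submatrix (GIndex.incl d i k) (GIndex.incl d i (k + 1)) =
      (gMatrix a x b i).submatrix id (GIndex.incl d i 1) := by
  induction k with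
  | zero => rfl
  | succ k ih => exact ih

end

/-! ### The minimal free resolution -/

section
open Matrix
variable {S : Type*} [CommRing S] {d : ℕ}

/-- The Koszul complex of a system of parameters `a, b` of a Cohen–Macaulay ring is exact in positive
degrees: each element of a maximal regular sequence has a power in `(a, b)`, and the coefficients of
such a power give a homotopy. -/
theorem coneMatrix_exact_of_isCohenMacaulay [IsLocalRing S] (hCM : IsCohenMacaulayLocalRing S)
    {a : Fin d → S} {b : S} (hab : IsSystemOfParameters (Fin.snoc a b : Fin (d + 1) → S)) (j : ℕ) :
    ExactMod ⊥ (coneMatrix a b j) (coneMatrix a b (j + 1)) := by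
  obtain ⟨-, rs, hrs, hreg, hlen⟩ := hCM
  have hlen' : rs.length = d + 1 := by
    rw [← hab.1] at hlen
    exact_mod_cast hlen
  have hn : ∀ i, d + 1 < i → IsEmpty (ConeIndex d i) := by
    rintro (_ | i) hi
    · omega
    · have := KoszulIndex.isEmpty_of_lt (d := d) (p := i + 1) (by omega)
      have := KoszulIndex.isEmpty_of_lt (d := d) (p := i) (by omega)
      exact inferInstanceAs (IsEmpty (KoszulIndex d (i + 1) ⊕ KoszulIndex d i))
  have key := exactMod_of_isWeaklyRegular (coneMatrix a b) (coneMatrix_mul_coneMatrix a b) hn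
    hreg.toIsWeaklyRegular ?_ rs.length 0 j (by omega) (by omega)
  · simpa using key
  · intro r hr
    have hr' := hrs r hr
    rw [← hab.2] at hr'
    obtain ⟨N, hN⟩ := hr'
    obtain ⟨c, hc⟩ := Ideal.mem_span_range_iff_exists_fun.1 hN
    refine ⟨N, coneHomotopy (fun i => c i.castSucc) (c (Fin.last d)), fun i => ?_⟩
    rw [coneMatrix_homotopy, ← hc, Fin.sum_univ_castSucc]
    simp [mul_comm]

end

theorem theorem3p2 {S : Type*} [CommRing S] [IsLocalRing S]
    (hCM : IsCohenMacaulayLocalRing S)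
    (d : ℕ) (hd : 1 ≤ d) (hdim : ringKrullDim S = ((d + 1 : ℕ) : WithBot ℕ∞))
    (f : S) (hf : f ∈ IsLocalRing.maximalIdeal S) (hf' : f ∈ nonZeroDivisors S)
    (a x : Fin d → S) (b ε : S)
    (hab : IsSystemOfParameters (Fin.snoc a b : Fin (d + 1) → S))
    (hx : ∀ i, x i ∈ Ideal.span (insert b (Set.range a)))
    (hε : IsUnit ε)
    (hrel : b ^ 2 + ∑ i, a i * x i = ε * f) :
    -- `∂_i ∂_{i+1} = [O | gE]` with `g = ε f`; the zero block is split along `K_{i+1} ⊕ K_i`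
    (∀ i : ℕ, gMatrix a x b i * gMatrix a x b (i + 1) =
      (Matrix.fromCols (0 : Matrix (GIndex d i) (KoszulIndex d (i + 2)) S)
        (Matrix.fromCols (0 : Matrix (GIndex d i) (KoszulIndex d (i + 1)) S)
          ((ε * f) • (1 : Matrix (GIndex d i) (GIndex d i) S))) :
        Matrix (GIndex d i) (GIndex d (i + 2)) S)) ∧
    -- `G_i = G_d` for `i ≥ d`, and under this identification `∂_i = ∂_{d+1}` for `i ≥ d + 1`
    (∀ k : ℕ, Function.Bijective (GIndex.incl d d k) ∧
      (gMatrix a x b (d + k)).submatrix (GIndex.incl d d k) (GIndex.incl d d (k + 1)) =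
        (gMatrix a x b d).submatrix id (GIndex.incl d d 1)) ∧
    -- `R = S/(f)` is local, and `F = G ⊗ R` is a minimal free resolution of `R/I`, where `I` is the
    -- ideal generated by the images of `a₁, …, a_d, b`
    ∃ _ : IsLocalRing (S ⧸ Ideal.span {f}),
      IsMinimalFreeResolution (fun i => GIndex d i → S ⧸ Ideal.span {f}) (fMap f a x b)
        (augmentation d
          ((Ideal.span (insert b (Set.range a))).map (Ideal.Quotient.mk (Ideal.span {f})))) := by
  have hprod := fun i => hrel ▸ gMatrix_mul_gMatrix a x b i
  refine ⟨hprod, fun k => ⟨GIndex.incl_bijective k, gMatrix_submatrix_incl a x b d k⟩, ?_⟩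
  have hNoeth := hCM.1
  -- `a`, `b` and `x` have their entries in the maximal ideal
  have hmem : ∀ i, (Fin.snoc a b : Fin (d + 1) → S) i ∈ IsLocalRing.maximalIdeal S := fun i => by
    rw [← hab.2]
    exact Ideal.le_radical (Ideal.subset_span ⟨i, rfl⟩)
  have ha : ∀ i, a i ∈ IsLocalRing.maximalIdeal S := fun i => by simpa using hmem i.castSucc
  have hb : b ∈ IsLocalRing.maximalIdeal S := by simpa using hmem (Fin.last d)
  have hle : Ideal.span (insert b (Set.range a)) ≤ IsLocalRing.maximalIdeal S := by
    rw [Ideal.span_le, Set.insert_subset_iff]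
    exact ⟨hb, Set.range_subset_iff.2 ha⟩
  have haI : ∀ i, a i ∈ Ideal.span (insert b (Set.range a)) := fun i =>
    Ideal.subset_span (Set.mem_insert_of_mem _ (Set.mem_range_self i))
  have hbI : b ∈ Ideal.span (insert b (Set.range a)) := Ideal.subset_span (Set.mem_insert _ _)
  have hcone := coneMatrix_exact_of_isCohenMacaulay hCM hab
  have hba : ∀ s, b * s ∈ Ideal.span (Set.range a) → s ∈ Ideal.span (Set.range a) :=
    fun s => mem_of_mul_mem_of_coneMatrix_exact (hcone 0)
  have hax : ∑ i, a i * x i ∈ Ideal.span (Set.range a) :=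
    Ideal.sum_mem _ fun i _ => Ideal.mul_mem_right _ _ (Ideal.subset_span ⟨i, rfl⟩)
  obtain ⟨η, hη⟩ := hε.exists_right_inv
  have hfb : f = η * (b ^ 2 + ∑ i, a i * x i) := by
    linear_combination (-f) * hη - η * hrel
  -- `f` is regular modulo `a` because `ε f ≡ b²`
  have hfa : ∀ s, f * s ∈ Ideal.span (Set.range a) → s ∈ Ideal.span (Set.range a) := by
    intro s hs
    refine hba s (hba _ ?_)
    have h1 := Ideal.sub_mem _ (Ideal.mul_mem_left _ ε hs) (Ideal.mul_mem_left _ s hax)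
    convert h1 using 1
    linear_combination s * hrel
  -- if `b s ∈ (f) + (a)`, then `b (s - η b t) ∈ (a)` for some `t`
  have hbs : ∀ s, b * s ∈ Ideal.span {f} ⊔ Ideal.span (Set.range a) →
      s ∈ Ideal.span (insert b (Set.range a)) := by
    intro s hs
    obtain ⟨y, hy, z, hz, hyz⟩ := Submodule.mem_sup.1 hs
    obtain ⟨t, rfl⟩ := Ideal.mem_span_singleton'.1 hy
    refine Ideal.mem_span_insert.2 ⟨η * t, s - η * t * b, hba _ ?_, by ring⟩
    have h1 := Ideal.add_mem _ hz (Ideal.mul_mem_left _ (η * t) hax)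
    convert h1 using 1
    linear_combination (-hyz) + t * hfb
  have hJ : b ^ 2 + ∑ i, a i * x i ∈ Ideal.span {f} := by
    rw [hrel]
    exact Ideal.mul_mem_left _ _ (Ideal.mem_span_singleton_self f)
  have hexact := gMatrix_exactMod hJ hbs
    (koszulMatrix_exactMod_span_singleton hf' hfa (koszulMatrix_exact hb hcone))
  have hnt : Nontrivial (S ⧸ Ideal.span {f}) := Ideal.Quotient.nontrivial_iff.2 fun h => by
    rw [Ideal.span_singleton_eq_top] at h
    exact (IsLocalRing.mem_maximalIdeal f).1 hf h
  have hloc : IsLocalRing (S ⧸ Ideal.span {f}) :=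
    IsLocalRing.of_surjective' (Ideal.Quotient.mk (Ideal.span {f})) Ideal.Quotient.mk_surjective
  have hcomap : (IsLocalRing.maximalIdeal (S ⧸ Ideal.span {f})).comap
      (Ideal.Quotient.mk (Ideal.span {f})) = IsLocalRing.maximalIdeal S :=
    IsLocalRing.eq_maximalIdeal
      (Ideal.comap_isMaximal_of_surjective _ Ideal.Quotient.mk_surjective)
  refine ⟨hloc, fun i => inferInstance, fun i => inferInstance, fun i => ?_, ?_, ?_, ?_⟩
  · refine exact_mulVecLin_map_mk (hexact i) fun p q => ?_
    rw [hprod]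
    rcases q with q | q | q
    · exact Ideal.zero_mem _
    · exact Ideal.zero_mem _
    · exact Ideal.mul_mem_right _ _ (Ideal.mul_mem_left _ _ (Ideal.mem_span_singleton_self f))
  · intro v
    constructor
    · intro hv
      have hv' : v (default : KoszulIndex d 0) ∈ (Ideal.span (insert b (Set.range a))).map
          (Ideal.Quotient.mk (Ideal.span {f})) := (Submodule.Quotient.mk_eq_zero _).1 hv
      obtain ⟨s, hs, hsv⟩ :=
        (Ideal.mem_map_iff_of_surjective _ Ideal.Quotient.mk_surjective).1 hv'
      obtain ⟨y, hy⟩ := exists_gMatrix_zero_mulVec_eq x hs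
      refine ⟨Ideal.Quotient.mk _ ∘ y, funext fun i => ?_⟩
      refine (RingHom.map_mulVec _ (gMatrix a x b 0) y i).symm.trans ?_
      obtain rfl : i = (default : KoszulIndex d 0) := Subsingleton.elim (α := KoszulIndex d 0) _ _
      exact (congrArg _ (hy default)).trans hsv
    · rintro ⟨u, rfl⟩
      refine (Submodule.Quotient.mk_eq_zero _).2 (mulVec_apply_mem_of_matrix_mem (fun p q => ?_) u _)
      exact Ideal.mem_map_of_mem _ (gMatrix_apply_mem (i := 0) haI hx hbI p q)
  · intro y
    obtain ⟨s, rfl⟩ := Submodule.Quotient.mk_surjective _ y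
    exact ⟨fun _ => s, rfl⟩
  · rintro i _ ⟨u, rfl⟩
    refine mem_smul_top_of_forall_mem (mulVec_apply_mem_of_matrix_mem (fun p q => ?_) u)
    have h := gMatrix_apply_mem ha (fun i => hle (hx i)) hb p q
    rw [← hcomap] at h
    exact h
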